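/- For $n\ge 0$ let $S_n$ be the set of permutations of $\{1,\dots,n\}$ in one-line notation. A pass through a stack reads the entries of a permutation from left to right; before an entry $a$ is pushed, the entries on top of the stack that are smaller than $a$ are popped, one after the other, to the output (so that no entry is placed on top of a smaller one), and at the end the stack is emptied to the output. A permutation $\pi\in S_n$ is two-stack sortable if two successive passes transform it into $12\ldots n$. Let $\mathcal P(132)$ be the set of all two-stack sortable permutations, of any length $n\ge 0$ (including the empty permutation), that contain no subsequence of type $132$. For $d\ge 1$ let $12\ldots d(\pi)$ be the number of increasing subsequences of length $d$ of $\pi$. **Theorem.** Let $x_1,x_2,\ldots$ be indeterminates. Then, as formal power series in $x_1,x_2,\ldots$ with integer coefficients (both infinite sums converge coefficientwise), $$\sum_{\pi\in\mathcal P(132)}\ \prod_{d\ge1}x_d^{12\ldots d(\pi)} =1+\sum_{n\ge1}\frac{\prod_{j\ge1}x_j^{\binom nj}} {\prod_{m=1}^n\left(1-\prod_{j\ge1}x_j^{\binom{m-1}{j-1}}-\prod_{j\ge1}x_j^{2\binom{m-1}{j-1}}x_{j+1}^{\binom{m-1}{j-1}}\right)}.$$ -/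

import Mathlib

open scoped MvPowerSeries.WithPiTopology

/-- The occurrences of the pattern `τ` in `π`: the choices of `k` positions `f 0 < ⋯ < f (k-1)` of
`π` at which the entries of `π` have the same pairwise comparisons as the entries of `τ`. -/
def patternOccurrences {k n : ℕ} (τ : Equiv.Perm (Fin k)) (π : Equiv.Perm (Fin n)) :
    Set (Fin k ↪o Fin n) :=
  {f | ∀ i j : Fin k, π (f i) < π (f j) ↔ τ i < τ j}

/-- `π` avoids the pattern `τ`. -/
def AvoidsPattern {k n : ℕ} (τ : Equiv.Perm (Fin k)) (π : Equiv.Perm (Fin n)) : Prop :=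
  patternOccurrences τ π = ∅

/-- The number of subsequences of type `12…d` in `π`. -/
noncomputable def incCount (d : ℕ) {n : ℕ} (π : Equiv.Perm (Fin n)) : ℕ :=
  (patternOccurrences (1 : Equiv.Perm (Fin d)) π).ncard

/-- The pattern `132` (in one-line notation on `{0, 1, 2}`: `0, 2, 1`). -/
def perm132 : Equiv.Perm (Fin 3) := Equiv.swap 1 2

/-- One-line notation of a permutation. -/
def oneLine {n : ℕ} (π : Equiv.Perm (Fin n)) : List (Fin n) := List.ofFn π

/-- One pass through a stack. The first argument is the current stack (top first), the second one
the remaining input, the result is the output. Before the next input entry `a` is pushed, the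
entries on top of the stack that are smaller than `a` are popped to the output, so that no entry is
ever placed on top of a smaller one; when the input is exhausted, the stack is emptied. -/
def stackPass {α : Type*} [LinearOrder α] : List α → List α → List α
  | st, [] => st
  | st, a :: l =>
      st.takeWhile (fun b => decide (b < a)) ++
        stackPass (a :: st.dropWhile (fun b => decide (b < a))) l

/-- The stack-sorting map: a pass through an initially empty stack. -/
def stackSort {α : Type*} [LinearOrder α] (l : List α) : List α := stackPass [] l

/-- `π` is two-stack sortable: two passes through a stack turn `π` into `1 2 … n`. -/
def IsTwoStackSortable {n : ℕ} (π : Equiv.Perm (Fin n)) : Prop :=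
  stackSort (stackSort (oneLine π)) = oneLine (1 : Equiv.Perm (Fin n))

/-- The set `P(132)` of all two-stack sortable permutations, of any length `n ≥ 0`, that
avoid `132`. -/
def P132 : Set (Σ n : ℕ, Equiv.Perm (Fin n)) :=
  {π | IsTwoStackSortable π.2 ∧ AvoidsPattern perm132 π.2}

/-- The factor
`1 - ∏_{j ≥ 1} x_j ^ C(m-1, j-1) - ∏_{j ≥ 1} x_j ^ (2 C(m-1, j-1)) x_{j+1} ^ C(m-1, j-1)`. -/
noncomputable def denomFactor (m : ℕ) : MvPowerSeries ℕ+ ℤ :=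
  1 - ∏ᶠ j : ℕ+, MvPowerSeries.X j ^ (m - 1).choose ((j : ℕ) - 1)
    - ∏ᶠ j : ℕ+, MvPowerSeries.X j ^ (2 * (m - 1).choose ((j : ℕ) - 1))
        * MvPowerSeries.X (j + 1) ^ (m - 1).choose ((j : ℕ) - 1)

theorem finite_choose_ne_zero (m : ℕ) :
    {j : ℕ+ | (m - 1).choose ((j : ℕ) - 1) ≠ 0}.Finite := by
  refine Set.Finite.subset (Set.finite_Iic (⟨m + 1, Nat.succ_pos m⟩ : ℕ+)) ?_
  intro j hj
  have h : (j : ℕ) - 1 ≤ m - 1 := by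
    by_contra hlt
    exact hj (Nat.choose_eq_zero_of_lt (not_le.mp hlt))
  change (j : ℕ) ≤ m + 1
  omega

theorem constantCoeff_denomFactor (m : ℕ) :
    MvPowerSeries.constantCoeff (denomFactor m) = 1 := by
  have key : ∀ g : ℕ+ → MvPowerSeries ℕ+ ℤ,
      (∀ j : ℕ+, (m - 1).choose ((j : ℕ) - 1) = 0 → g j = 1) →
      MvPowerSeries.constantCoeff (g 1) = 0 →
      MvPowerSeries.constantCoeff (∏ᶠ j, g j) = 0 := by
    intro g hg h1
    have hfin : (Function.mulSupport g).Finite := by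
      refine (finite_choose_ne_zero m).subset ?_
      intro j hj h0
      exact hj (hg j h0)
    rw [finprod_eq_prod _ hfin, map_prod]
    refine Finset.prod_eq_zero (i := 1) ?_ h1
    rw [Set.Finite.mem_toFinset]
    intro h
    rw [h] at h1
    simp at h1
  unfold denomFactor
  rw [map_sub, map_sub, key, key]
  · simp
  · intro j hj
    simp [hj]
  · simp
  · intro j hj
    simp [hj]
  · simp

/-- The denominator `∏_{m=1}^n denomFactor m` of the `n`-th summand. -/
noncomputable def denom (n : ℕ) : MvPowerSeries ℕ+ ℤ :=
  ∏ m ∈ Finset.Icc 1 n, denomFactor m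

/-- The reciprocal `1 / denom n` in the ring of formal power series (`invOfUnit _ 1` is the
inverse of a series with constant coefficient `1`). -/
noncomputable def denomInv (n : ℕ) : MvPowerSeries ℕ+ ℤ :=
  MvPowerSeries.invOfUnit (denom n) 1

theorem denom_mul_denomInv (n : ℕ) : denom n * denomInv n = 1 := by
  refine MvPowerSeries.mul_invOfUnit _ _ ?_
  simp [denom, map_prod, constantCoeff_denomFactor]

/-! Let N be the largest entry of a nonempty word L N R in the class. Avoiding 132 means in
particular that every entry of L exceeds every entry of R. Writing S for one pass, S(L N R) = S(L)
S(R) N. If L = L₁ M L₂ with M = max L, two passes therefore give S(S(L₁) S(L₂)) S(S(R)) M N. If R is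
nonempty, this is increasing only when L₁ and L₂ are empty. So the word is a single entry, σ n, n σ
or (n-1) n σ with σ nonempty in the class, and the shape is unique (`IsP132Word.exists_toList_eq`,
`PellWord.toList_injective`).

A final maximum extends every increasing subsequence: σ n contributes x_1 times the monomial of σ
under x_d ↦ x_d x_{d+1}. The prefixes n and (n-1) n only add factors x_1 and x_1^2 x_2. With G_k the
generating function of nonempty words after k substitutions and m_k the image of x_1, this reads G_k
= m_k (1 + G_{k+1}) + m_k G_k + m_k m_{k+1} G_k (`PellWord.genFun_eq`). Solving for G_k and
iterating gives the series; the remainder after n steps is divisible by x_1^n, hence vanishes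
coefficientwise (`PellWord.hasSum_term`). -/

/-- Codes of the nonempty `132`-avoiding two-stack sortable permutations: `12…n` with `n = 1`, and
the operations `σ ↦ σ n`, `σ ↦ n σ` and `σ ↦ (n-1) n σ`. -/
inductive PellWord : Type
  | one : PellWord
  | snoc : PellWord → PellWord
  | cons : PellWord → PellWord
  | dbl : PellWord → PellWord

/-! ### Exponents under the substitution, and the denominators -/

/-- The effect on exponents of the substitution `x_d ↦ x_d x_{d+1}`. -/
noncomputable def shiftExp : AddMonoid.End (ℕ+ →₀ ℕ) :=
  AddMonoidHom.id _ + Finsupp.mapDomain.addMonoidHom (· + 1)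

theorem shiftExp_apply (e : ℕ+ →₀ ℕ) : shiftExp e = e + Finsupp.mapDomain (· + 1) e := rfl

theorem pnat_add_one_ne_one (d : ℕ+) : d + 1 ≠ 1 := (PNat.lt_add_left 1 d).ne'

theorem mapDomain_add_one_apply_one (e : ℕ+ →₀ ℕ) :
    Finsupp.mapDomain (· + 1) e (1 : ℕ+) = 0 := by
  refine Finsupp.mapDomain_of_notMem_range _ _ ?_
  rintro ⟨d, hd⟩
  exact pnat_add_one_ne_one d hd

theorem mapDomain_add_one_apply_add_one (e : ℕ+ →₀ ℕ) (d : ℕ+) :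
    Finsupp.mapDomain (· + 1) e (d + 1) = e d :=
  Finsupp.mapDomain_apply (add_left_injective 1) e d

theorem shiftExp_apply_one (e : ℕ+ →₀ ℕ) : shiftExp e 1 = e 1 := by
  rw [shiftExp_apply, Finsupp.add_apply, mapDomain_add_one_apply_one, add_zero]

theorem shiftExp_apply_add_one (e : ℕ+ →₀ ℕ) (d : ℕ+) :
    shiftExp e (d + 1) = e (d + 1) + e d := by
  rw [shiftExp_apply, Finsupp.add_apply, mapDomain_add_one_apply_add_one]

theorem shiftExp_pow_apply_one (k : ℕ) (e : ℕ+ →₀ ℕ) : (shiftExp ^ k) e 1 = e 1 := by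
  induction k with
  | zero => simp
  | succ k ih => rw [pow_succ', AddMonoid.End.coe_mul, Function.comp_apply, shiftExp_apply_one, ih]

/-- The exponent of `∏ x_j ^ C(k, j-1)`. -/
noncomputable def chooseExp (k : ℕ) : ℕ+ →₀ ℕ := (shiftExp ^ k) (Finsupp.single 1 1)

theorem chooseExp_succ (k : ℕ) : chooseExp (k + 1) = shiftExp (chooseExp k) := by
  rw [chooseExp, pow_succ', AddMonoid.End.coe_mul, Function.comp_apply, chooseExp]

theorem chooseExp_apply (k : ℕ) (j : ℕ+) : chooseExp k j = k.choose ((j : ℕ) - 1) := by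
  induction k generalizing j with
  | zero =>
    induction j using PNat.recOn with
    | one => simp [chooseExp]
    | succ j _ =>
      have h : (1 : ℕ+) ≠ j + 1 := (pnat_add_one_ne_one j).symm
      have hj : Nat.choose 0 (j : ℕ) = 0 := Nat.choose_eq_zero_of_lt j.pos
      simp [chooseExp, h, hj]
  | succ k ih =>
    rw [chooseExp_succ]
    induction j using PNat.recOn with
    | one => rw [shiftExp_apply_one, ih]; simp
    | succ j _ =>
      rw [shiftExp_apply_add_one, ih, ih]
      obtain ⟨i, hi⟩ : ∃ i, (j : ℕ) = i + 1 := ⟨j - 1, by have := j.pos; omega⟩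
      simp [hi, Nat.choose_succ_succ, add_comm]

/-- The exponent of `∏ x_j ^ C(n, j)`. -/
noncomputable def chooseSumExp (n : ℕ) : ℕ+ →₀ ℕ := ∑ m ∈ Finset.range n, chooseExp m

theorem chooseSumExp_apply (n : ℕ) (j : ℕ+) : chooseSumExp n j = n.choose j := by
  induction n with
  | zero => simp [chooseSumExp, Nat.choose_eq_zero_of_lt j.pos]
  | succ n ih =>
    rw [chooseSumExp, Finset.sum_range_succ, Finsupp.add_apply, ← chooseSumExp, ih,
      chooseExp_apply]
    obtain ⟨i, hi⟩ : ∃ i, (j : ℕ) = i + 1 := ⟨j - 1, by have := j.pos; omega⟩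
    simp [hi, Nat.choose_succ_succ, add_comm]

theorem finprod_X_pow (e : ℕ+ →₀ ℕ) :
    (∏ᶠ d : ℕ+, MvPowerSeries.X d ^ e d : MvPowerSeries ℕ+ ℤ) = MvPowerSeries.monomial e 1 := by
  rw [MvPowerSeries.monomial_eq', map_one, one_mul, Finsupp.prod]
  refine finprod_eq_prod_of_mulSupport_subset _ fun d hd => ?_
  rw [Finset.mem_coe, Finsupp.mem_support_iff]
  rintro h
  exact hd (by simp [h])

/-- The last monomial is the image of x_1^2 x_2 = x_1 · (x_1 x_2) under k substitutions: with e =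
`chooseExp k`, twice e plus its translate is e + `shiftExp` e. -/
theorem denomFactor_succ (k : ℕ) :
    denomFactor (k + 1) = 1 - MvPowerSeries.monomial (chooseExp k) 1
      - MvPowerSeries.monomial (chooseExp k + chooseExp (k + 1)) 1 := by
  have h1 : ∀ j : ℕ+, (k + 1 - 1).choose ((j : ℕ) - 1) = chooseExp k j := fun j =>
    (chooseExp_apply k j).symm
  have hfin (c : ℕ) (g : ℕ+ → ℕ+) : Function.HasFiniteMulSupport fun j : ℕ+ =>
      (MvPowerSeries.X (g j) ^ (c * chooseExp k j) : MvPowerSeries ℕ+ ℤ) := by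
    refine (chooseExp k).support.finite_toSet.subset fun j hj => ?_
    rw [Finset.mem_coe, Finsupp.mem_support_iff]
    exact fun h => hj (by simp [h])
  simp only [denomFactor, h1]
  rw [finprod_X_pow, finprod_mul_distrib (by simpa using hfin 2 id) (by simpa using hfin 1 (· + 1))]
  have h2 : (∏ᶠ j : ℕ+, MvPowerSeries.X (j + 1) ^ chooseExp k j : MvPowerSeries ℕ+ ℤ)
      = MvPowerSeries.monomial (Finsupp.mapDomain (· + 1) (chooseExp k)) 1 := by
    rw [MvPowerSeries.monomial_eq', map_one, one_mul, Finsupp.prod_mapDomain_index (by simp)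
      (by intros; exact pow_add _ _ _), Finsupp.prod]
    refine finprod_eq_prod_of_mulSupport_subset _ fun d hd => ?_
    rw [Finset.mem_coe, Finsupp.mem_support_iff]
    exact fun h => hd (by simp [h])
  have h3 := finprod_X_pow (2 • chooseExp k)
  simp only [Finsupp.smul_apply, smul_eq_mul] at h3
  rw [h2]
  rw [h3, MvPowerSeries.monomial_mul_monomial, one_mul, chooseExp_succ, shiftExp_apply, two_nsmul,
    add_assoc]

theorem denomInv_eq_mul_denomInv_succ (n : ℕ) :
    denomInv n = denomInv (n + 1) * denomFactor (n + 1) := by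
  have h : denom (n + 1) = denom n * denomFactor (n + 1) := Finset.prod_Icc_succ_top (by omega) _
  calc denomInv n = denomInv n * (denom (n + 1) * denomInv (n + 1)) := by
        rw [denom_mul_denomInv, mul_one]
    _ = (denom n * denomInv n) * (denomInv (n + 1) * denomFactor (n + 1)) := by rw [h]; ring
    _ = _ := by rw [denom_mul_denomInv, one_mul]

theorem denomInv_zero : denomInv 0 = 1 := by
  simpa [denom] using denom_mul_denomInv 0

theorem MvPowerSeries.summable_of_finite_coeff {ι : Type*} {f : ι → MvPowerSeries ℕ+ ℤ}
    (h : ∀ a, {i | MvPowerSeries.coeff a (f i) ≠ 0}.Finite) : Summable f :=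
  MvPowerSeries.WithPiTopology.summable_iff_summable_coeff.2 fun a =>
    summable_of_hasFiniteSupport (h a)

/-! ### Generating function of the codes: functional equation and iteration -/

namespace PellWord

/-- The length of the coded permutation. -/
def length : PellWord → ℕ
  | one => 1
  | snoc p => p.length + 1
  | cons p => p.length + 1
  | dbl p => p.length + 2

/-- The exponent `d ↦ 12…d(π)` of the coded permutation `π`. -/
noncomputable def expo : PellWord → (ℕ+ →₀ ℕ)
  | one => Finsupp.single 1 1
  | snoc p => Finsupp.single 1 1 + shiftExp p.expo
  | cons p => Finsupp.single 1 1 + p.expo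
  | dbl p => (Finsupp.single 1 1 + shiftExp (Finsupp.single 1 1)) + p.expo

/-- Since the substitution also preserves the exponent of x_1, only finitely many codes contribute
to a given coefficient, whatever k is. -/
theorem expo_apply_one (p : PellWord) : p.expo 1 = p.length := by
  induction p with
  | one => simp [expo, length]
  | snoc p ih => simp [expo, length, shiftExp_apply_one, ih, add_comm]
  | cons p ih => simp [expo, length, ih, add_comm]
  | dbl p ih => simp [expo, length, ih, shiftExp_apply_one, add_comm]

theorem finite_length_le (n : ℕ) : {p : PellWord | p.length ≤ n}.Finite := by
  induction n with
  | zero =>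
    convert Set.finite_empty
    ext p
    cases p <;> simp [length]
  | succ n ih =>
    refine ((((Set.finite_singleton one).union (ih.image snoc)).union (ih.image cons)).union
      (ih.image dbl)).subset ?_
    rintro (_ | p | p | p) hp
    · simp
    · simpa [length] using hp
    · simpa [length] using hp
    · simp only [length, Set.mem_ofPred_eq] at hp
      simp
      omega

/-- The case distinction on the outermost operation. -/
def equivSum : (Unit ⊕ PellWord) ⊕ (PellWord ⊕ PellWord) ≃ PellWord where
  toFun := Sum.elim (Sum.elim (fun _ => one) snoc) (Sum.elim cons dbl)
  invFun
    | one => Sum.inl (Sum.inl ())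
    | snoc p => Sum.inl (Sum.inr p)
    | cons p => Sum.inr (Sum.inl p)
    | dbl p => Sum.inr (Sum.inr p)
  left_inv := by rintro ((_ | _) | (_ | _)) <;> rfl
  right_inv := by rintro (_ | _ | _ | _) <;> rfl

/-- The generating function after the substitution `x_d ↦ x_d x_{d+1}` has been made `k` times. -/
noncomputable def genFun (k : ℕ) : MvPowerSeries ℕ+ ℤ :=
  ∑' p : PellWord, MvPowerSeries.monomial ((shiftExp ^ k) p.expo) 1

theorem hasSum_genFun (k : ℕ) :
    HasSum (fun p : PellWord => (MvPowerSeries.monomial ((shiftExp ^ k) p.expo) 1 :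
      MvPowerSeries ℕ+ ℤ)) (genFun k) := by
  refine (MvPowerSeries.summable_of_finite_coeff fun a => ?_).hasSum
  refine (finite_length_le (a 1)).subset fun p hp => ?_
  classical
  rw [Set.mem_ofPred_eq, MvPowerSeries.coeff_monomial, ne_eq, ite_eq_right_iff] at hp
  have h : a = (shiftExp ^ k) p.expo := by
    by_contra h
    exact hp fun h' => absurd h' h
  rw [Set.mem_ofPred_eq, h, shiftExp_pow_apply_one, expo_apply_one]

/-- One summand for each outermost operation. Only `snoc` shifts the inner exponent once more, which
turns `genFun k` into `genFun (k + 1)`. -/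
theorem genFun_eq (k : ℕ) :
    genFun k = (MvPowerSeries.monomial (chooseExp k) 1
      + MvPowerSeries.monomial (chooseExp k) 1 * genFun (k + 1))
      + (MvPowerSeries.monomial (chooseExp k) 1 * genFun k
      + MvPowerSeries.monomial (chooseExp k + chooseExp (k + 1)) 1 * genFun k) := by
  refine (hasSum_genFun k).unique ((Equiv.hasSum_iff equivSum).1 ?_)
  refine HasSum.sum (HasSum.sum ?_ ?_) (HasSum.sum ?_ ?_)
  · exact hasSum_unique fun _ : Unit =>
      (MvPowerSeries.monomial ((shiftExp ^ k) one.expo) 1 : MvPowerSeries ℕ+ ℤ)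
  · refine ((hasSum_genFun (k + 1)).mul_left
      (MvPowerSeries.monomial (chooseExp k) 1)).congr_fun fun p => ?_
    simp [equivSum, expo, MvPowerSeries.monomial_mul_monomial, chooseExp, pow_succ]
  · refine ((hasSum_genFun k).mul_left
      (MvPowerSeries.monomial (chooseExp k) 1)).congr_fun fun p => ?_
    simp [equivSum, expo, MvPowerSeries.monomial_mul_monomial, chooseExp]
  · refine ((hasSum_genFun k).mul_left
      (MvPowerSeries.monomial (chooseExp k + chooseExp (k + 1)) 1)).congr_fun fun p => ?_
    simp [equivSum, expo, MvPowerSeries.monomial_mul_monomial, chooseExp, pow_succ]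

theorem denomFactor_mul_genFun (k : ℕ) :
    denomFactor (k + 1) * genFun k
      = MvPowerSeries.monomial (chooseExp k) 1 * (1 + genFun (k + 1)) := by
  rw [denomFactor_succ]
  linear_combination genFun_eq k

/-- The `n`-th summand of the right-hand side. -/
noncomputable def term (n : ℕ) : MvPowerSeries ℕ+ ℤ :=
  MvPowerSeries.monomial (chooseSumExp n) 1 * denomInv n

/-- The numerator contains x_1 to the power C(n, 1) = n. -/
theorem coeff_term_mul_eq_zero {n : ℕ} {a : ℕ+ →₀ ℕ} (h : a 1 < n) (f : MvPowerSeries ℕ+ ℤ) :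
    MvPowerSeries.coeff a (term n * f) = 0 := by
  classical
  rw [term, mul_assoc, MvPowerSeries.coeff_monomial_mul, if_neg]
  intro hle
  have := hle 1
  rw [chooseSumExp_apply] at this
  simp at this
  omega

theorem term_mul_genFun (n : ℕ) :
    term n * genFun n = term (n + 1) + term (n + 1) * genFun (n + 1) := by
  have h : (MvPowerSeries.monomial (chooseSumExp (n + 1)) 1 : MvPowerSeries ℕ+ ℤ)
      = MvPowerSeries.monomial (chooseSumExp n) 1 * MvPowerSeries.monomial (chooseExp n) 1 := by
    rw [MvPowerSeries.monomial_mul_monomial, one_mul, chooseSumExp, Finset.sum_range_succ,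
      ← chooseSumExp]
  rw [term, term, denomInv_eq_mul_denomInv_succ n, h]
  linear_combination (MvPowerSeries.monomial (chooseSumExp n) 1 * denomInv (n + 1)) *
    denomFactor_mul_genFun n

theorem genFun_zero_eq (n : ℕ) :
    genFun 0 = ∑ i ∈ Finset.range n, term (i + 1) + term n * genFun n := by
  induction n with
  | zero => simp [term, denomInv_zero, chooseSumExp]
  | succ n ih => rw [ih, Finset.sum_range_succ, term_mul_genFun, add_assoc]

theorem hasSum_term : HasSum (fun n : ℕ+ => term n) (genFun 0) := by
  rw [← (Equiv.pnatEquivNat.symm).hasSum_iff, MvPowerSeries.WithPiTopology.hasSum_iff_hasSum_coeff]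
  intro a
  -- After `a 1 + 1` iterations the remainder is divisible by a power of x_1 exceeding `a 1`, so the
  -- coefficient at `a` is already a finite sum.
  rw [genFun_zero_eq (a 1 + 1), map_add, coeff_term_mul_eq_zero (Nat.lt_succ_self _), add_zero,
    map_sum]
  refine hasSum_sum_of_ne_finset_zero fun n hn => ?_
  rw [Finset.mem_range, not_lt] at hn
  simpa using coeff_term_mul_eq_zero (n := n + 1) (a := a) (by omega) 1

end PellWord

/-! ### The stack-sorting map around a largest entry -/

section StackSort

variable {α : Type*} [LinearOrder α]

theorem stackPass_perm (st l : List α) : (stackPass st l).Perm (st ++ l) := by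
  induction l generalizing st with
  | nil => simp [stackPass]
  | cons a l ih =>
    rw [stackPass]
    refine ((ih _).append_left _).trans ?_
    rw [List.cons_append]
    refine List.perm_middle.trans ?_
    rw [← List.append_assoc, List.takeWhile_append_dropWhile]
    exact List.perm_middle.symm

theorem stackSort_perm (l : List α) : (stackSort l).Perm l := stackPass_perm [] l

/-- The arrival of m empties the stack, so everything before m is output before R is read. -/
theorem stackPass_append_cons {m : α} {L : List α} (R : List α) {st : List α}
    (hL : ∀ x ∈ L, x < m) (hst : ∀ x ∈ st, x < m) :
    stackPass st (L ++ m :: R) = stackPass st L ++ stackPass [m] R := by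
  induction L generalizing st with
  | nil =>
    have h : ∀ x ∈ st, decide (x < m) = true := by simpa using hst
    simp [stackPass, List.takeWhile_eq_self_iff.2 h, List.dropWhile_eq_nil_iff.2 h]
  | cons a L ih =>
    rw [List.cons_append, stackPass, stackPass, ih, List.append_assoc]
    · exact fun x hx => hL x (List.mem_cons_of_mem _ hx)
    · intro x hx
      rcases List.mem_cons.1 hx with rfl | hx
      · exact hL x List.mem_cons_self
      · exact hst x ((List.dropWhile_suffix _).mem hx)

/-- An entry larger than all remaining input stays at the bottom of the stack until the end. -/
theorem stackPass_concat_stack {m : α} {R : List α} (st : List α) (hR : ∀ x ∈ R, x < m) :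
    stackPass (st ++ [m]) R = stackPass st R ++ [m] := by
  induction R generalizing st with
  | nil => simp [stackPass]
  | cons a R ih =>
    have ham : ¬ m < a := (hR a List.mem_cons_self).not_gt
    have h1 : (st ++ [m]).takeWhile (fun b => decide (b < a))
        = st.takeWhile (fun b => decide (b < a)) := by
      rw [List.takeWhile_append]
      split_ifs with h
      · rw [List.IsPrefix.eq_of_length (List.takeWhile_prefix _) h]
        simp [ham]
      · rfl
    have h2 : (st ++ [m]).dropWhile (fun b => decide (b < a))
        = st.dropWhile (fun b => decide (b < a)) ++ [m] := by
      have := List.takeWhile_append_dropWhile (p := fun b => decide (b < a)) (l := st ++ [m])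
      rw [h1] at this
      refine List.append_cancel_left (this.trans ?_)
      rw [← List.append_assoc, List.takeWhile_append_dropWhile]
    rw [stackPass, stackPass, h1, h2, ← List.cons_append, ih, List.append_assoc]
    exact fun x hx => hR x (List.mem_cons_of_mem _ hx)

theorem stackSort_append_cons {m : α} {L R : List α} (hL : ∀ x ∈ L, x < m)
    (hR : ∀ x ∈ R, x < m) :
    stackSort (L ++ m :: R) = stackSort L ++ stackSort R ++ [m] := by
  rw [stackSort, stackPass_append_cons R hL (by simp), ← List.nil_append [m],
    stackPass_concat_stack [] hR, List.append_assoc]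
  rfl

theorem stackPass_map {β : Type*} [LinearOrder β] {f : α → β} (hf : StrictMono f)
    (st l : List α) : stackPass (st.map f) (l.map f) = (stackPass st l).map f := by
  induction l generalizing st with
  | nil => simp [stackPass]
  | cons a l ih =>
    simp only [List.map_cons, stackPass, List.takeWhile_map, List.dropWhile_map, List.map_append,
      ← ih]
    simp [Function.comp_def, hf.lt_iff_lt]

theorem stackSort_map {β : Type*} [LinearOrder β] {f : α → β} (hf : StrictMono f)
    (l : List α) : stackSort (l.map f) = (stackSort l).map f := stackPass_map hf [] l

theorem stackSort_stackSort_concat {m : α} {L : List α} (hL : ∀ x ∈ L, x < m) :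
    stackSort (stackSort (L ++ [m])) = stackSort (stackSort L) ++ [m] := by
  rw [stackSort_append_cons hL (by simp)]
  simp only [stackSort, stackPass, List.append_nil]
  exact (stackSort_append_cons (fun x hx => hL x ((stackSort_perm L).mem_iff.1 hx))
    (by simp)).trans (by simp [stackSort, stackPass])

theorem stackSort_stackSort_cons {m : α} {R : List α} (hR : ∀ x ∈ R, x < m) :
    stackSort (stackSort (m :: R)) = stackSort (stackSort R) ++ [m] := by
  have h1 := stackSort_append_cons (L := []) (by simp) hR
  have h2 := stackSort_append_cons (L := stackSort R) (R := [])
    (fun x hx => hR x ((stackSort_perm R).mem_iff.1 hx)) (by simp)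
  simp only [stackSort, stackPass, List.append_nil, List.nil_append] at h1 h2 ⊢
  rw [h1, h2]

/-- The first pass outputs S(L₁) S(L₂) M S(R) m. The final m does not affect the second pass, and M
is the maximum of what precedes it, so the recursion applies again. -/
theorem stackSort_stackSort_append_cons {M m : α} {L₁ L₂ R : List α} (hMm : M < m)
    (hL₁ : ∀ x ∈ L₁, x < M) (hL₂ : ∀ x ∈ L₂, x < M) (hR : ∀ x ∈ R, x < M) :
    stackSort (stackSort ((L₁ ++ M :: L₂) ++ m :: R))
      = stackSort (stackSort L₁ ++ stackSort L₂) ++ stackSort (stackSort R) ++ [M, m] := by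
  have h1 : ∀ x ∈ L₁ ++ M :: L₂, x < m := by
    simp only [List.mem_append, List.mem_cons]
    rintro x (hx | rfl | hx)
    · exact (hL₁ x hx).trans hMm
    · exact hMm
    · exact (hL₂ x hx).trans hMm
  rw [stackSort_append_cons h1 fun x hx => (hR x hx).trans hMm, stackSort_append_cons hL₁ hL₂]
  have h2 : ∀ x ∈ stackSort L₁ ++ stackSort L₂, x < M := by
    simp only [List.mem_append, (stackSort_perm _).mem_iff]
    rintro x (hx | hx)
    · exact hL₁ x hx
    · exact hL₂ x hx
  have h3 : ∀ x ∈ stackSort R, x < M := fun x hx => hR x ((stackSort_perm R).mem_iff.1 hx)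
  have h4 := stackSort_append_cons h2 h3
  have h5 : ∀ x ∈ stackSort L₁ ++ stackSort L₂ ++ M :: stackSort R, x < m := by
    intro x hx
    rcases List.mem_append.1 hx with hx | hx
    · exact (h2 x hx).trans hMm
    · rcases List.mem_cons.1 hx with rfl | hx
      · exact hMm
      · exact (h3 x hx).trans hMm
  have h6 := stackSort_append_cons (R := []) h5 (by simp)
  rw [h4] at h6
  simp only [List.append_assoc, List.cons_append, List.nil_append] at h6 ⊢
  rw [h6]
  simp [stackSort, stackPass]

end StackSort

/-! ### Increasing subsequences and the pattern 132 in words -/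

/-- The increasing subsequences of length `d` of a list. -/
def incSublists (d : ℕ) (l : List ℕ) : Set (List ℕ) :=
  {t | t.Sublist l ∧ t.length = d ∧ t.Pairwise (· < ·)}

theorem finite_incSublists (d : ℕ) (l : List ℕ) : (incSublists d l).Finite :=
  (List.finite_toSet l.sublists).subset fun _ ht => List.mem_sublists.2 ht.1

theorem incSublists_zero (l : List ℕ) : incSublists 0 l = {[]} := by
  ext t
  simp only [incSublists, Set.mem_ofPred_eq, List.length_eq_zero_iff, Set.mem_singleton_iff]
  constructor
  · exact fun h => h.2.1
  · rintro rfl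
    simp

theorem incSublists_succ_nil (d : ℕ) : incSublists (d + 1) [] = ∅ := by
  ext t
  simp only [incSublists, Set.mem_ofPred_eq, List.sublist_nil, Set.mem_empty_iff_false, iff_false]
  rintro ⟨rfl, h, -⟩
  simp at h

/-- An increasing subsequence either misses the final maximum or is an arbitrary shorter one
extended by it. -/
theorem ncard_incSublists_concat {l : List ℕ} {n : ℕ} (d : ℕ) (h : ∀ x ∈ l, x < n) :
    (incSublists (d + 1) (l ++ [n])).ncard
      = (incSublists (d + 1) l).ncard + (incSublists d l).ncard := by
  have heq : incSublists (d + 1) (l ++ [n])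
      = incSublists (d + 1) l ∪ (· ++ [n]) '' incSublists d l := by
    ext t
    simp only [incSublists, Set.mem_ofPred_eq, Set.mem_union, Set.mem_image]
    constructor
    · rintro ⟨hs, hlen, hp⟩
      obtain ⟨t₁, t₂, rfl, h1, h2⟩ := List.sublist_append_iff.1 hs
      rcases List.sublist_singleton.1 h2 with rfl | rfl
      · rw [List.append_nil] at *
        exact Or.inl ⟨h1, hlen, hp⟩
      · exact Or.inr ⟨t₁, ⟨h1, by simpa using hlen, (List.pairwise_append.1 hp).1⟩, rfl⟩
    · rintro (⟨hs, hlen, hp⟩ | ⟨t, ⟨hs, hlen, hp⟩, rfl⟩)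
      · exact ⟨hs.trans (List.sublist_append_left _ _), hlen, hp⟩
      · refine ⟨hs.append_right _, by simpa using hlen, List.pairwise_append.2 ⟨hp, by simp, ?_⟩⟩
        intro a ha b hb
        rw [List.mem_singleton.1 hb]
        exact h a (hs.subset ha)
  rw [heq, Set.ncard_union_eq _ (finite_incSublists _ _) ((finite_incSublists _ _).image _),
    Set.ncard_image_of_injective _ (List.append_left_injective _)]
  rw [Set.disjoint_left]
  rintro _ ⟨hs, -⟩ ⟨t, -, rfl⟩
  exact (h n (hs.subset (by simp))).ne rfl

/-- Subsequences using the first entry n continue only among entries larger than n. -/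
theorem ncard_incSublists_cons {l : List ℕ} {n : ℕ} (d : ℕ) (h : n ∉ l) :
    (incSublists (d + 1) (n :: l)).ncard
      = (incSublists (d + 1) l).ncard + (incSublists d (l.filter (n < ·))).ncard := by
  have heq : incSublists (d + 1) (n :: l)
      = incSublists (d + 1) l ∪ (n :: ·) '' incSublists d (l.filter (n < ·)) := by
    ext t
    simp only [incSublists, Set.mem_ofPred_eq, Set.mem_union, Set.mem_image]
    constructor
    · rintro ⟨hs, hlen, hp⟩
      rcases List.sublist_cons_iff.1 hs with hs | ⟨t, rfl, hs'⟩
      · exact Or.inl ⟨hs, hlen, hp⟩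
      · rw [List.pairwise_cons] at hp
        refine Or.inr ⟨t, ⟨?_, by simpa using hlen, hp.2⟩, rfl⟩
        have := hs'.filter (fun x => decide (n < x))
        rwa [List.filter_eq_self.2 (by simpa using hp.1)] at this
    · rintro (⟨hs, hlen, hp⟩ | ⟨t, ⟨hs, hlen, hp⟩, rfl⟩)
      · exact ⟨hs.trans (List.sublist_cons_self _ _), hlen, hp⟩
      · refine ⟨(hs.trans List.filter_sublist).cons_cons _, by simpa using hlen,
          List.pairwise_cons.2 ⟨fun a ha => ?_, hp⟩⟩
        simpa using (List.mem_filter.1 (hs.subset ha)).2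
  rw [heq, Set.ncard_union_eq _ (finite_incSublists _ _) ((finite_incSublists _ _).image _),
    Set.ncard_image_of_injective _ List.cons_injective]
  rw [Set.disjoint_left]
  rintro _ ⟨hs, -⟩ ⟨t, -, rfl⟩
  exact h (hs.subset (by simp))

/-- `l` has no subsequence of type `132`. -/
def ListAvoids132 (l : List ℕ) : Prop :=
  ∀ a b c : ℕ, a < c → c < b → ¬ [a, b, c].Sublist l

theorem ListAvoids132.sublist {l l' : List ℕ} (h : ListAvoids132 l) (hs : l'.Sublist l) :
    ListAvoids132 l' := fun a b c hac hcb ht => h a b c hac hcb (ht.trans hs)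

theorem ListAvoids132.concat {l : List ℕ} {n : ℕ} (h : ListAvoids132 l) (hn : ∀ x ∈ l, x < n) :
    ListAvoids132 (l ++ [n]) := by
  intro a b c hac hcb hs
  have hb : b ≤ n := by
    have := hs.subset (show b ∈ [a, b, c] by simp)
    rcases List.mem_append.1 this with hb | hb
    · exact (hn b hb).le
    · exact (List.mem_singleton.1 hb).le
  obtain ⟨t₁, t₂, ht, h1, h2⟩ := List.sublist_append_iff.1 hs
  rcases List.sublist_singleton.1 h2 with rfl | rfl
  · rw [List.append_nil] at ht
    exact h a b c hac hcb (ht ▸ h1)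
  · have := congrArg List.getLast? ht
    simp at this
    omega

theorem ListAvoids132.cons {l : List ℕ} {n : ℕ} (h : ListAvoids132 l)
    (hn : ∀ b c : ℕ, n < c → c < b → ¬ [b, c].Sublist l) : ListAvoids132 (n :: l) := by
  intro a b c hac hcb hs
  rcases List.sublist_cons_iff.1 hs with hs | ⟨t, ht, hs⟩
  · exact h a b c hac hcb hs
  · obtain ⟨rfl, rfl⟩ := List.cons.inj ht
    exact hn b c hac hcb hs

/-- The one-line notations, with entries `0, …, n - 1`, of the two-stack sortable permutations that
avoid `132`. -/
def IsP132Word (l : List ℕ) : Prop :=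
  l.Perm (List.range l.length) ∧ ListAvoids132 l ∧ (stackSort (stackSort l)).Pairwise (· < ·)

theorem pairwise_concat_iff {l : List ℕ} {n : ℕ} (h : ∀ x ∈ l, x < n) :
    (l ++ [n]).Pairwise (· < ·) ↔ l.Pairwise (· < ·) := by
  rw [List.pairwise_append]
  simp
  exact fun _ => h

theorem mem_stackSort_stackSort {l : List ℕ} {x : ℕ} : x ∈ stackSort (stackSort l) ↔ x ∈ l := by
  rw [(stackSort_perm _).mem_iff, (stackSort_perm _).mem_iff]

/-! ### The codes correspond bijectively to the nonempty words of the class -/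

namespace PellWord

/-- The coded permutation in one-line notation, with entries `0, …, n - 1`. -/
def toList : PellWord → List ℕ
  | one => [0]
  | snoc p => p.toList ++ [p.length]
  | cons p => p.length :: p.toList
  | dbl p => p.length :: (p.length + 1) :: p.toList

theorem length_toList (p : PellWord) : p.toList.length = p.length := by
  induction p <;> simp_all [toList, length]

theorem toList_perm (p : PellWord) : p.toList.Perm (List.range p.length) := by
  induction p with
  | one => simp [toList, length]
  | snoc p ih =>
    rw [toList, length, List.range_succ]
    exact ih.append_right _
  | cons p ih =>
    rw [toList, length, List.range_succ]
    exact (ih.cons _).trans (List.perm_append_singleton _ _).symm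
  | dbl p ih =>
    rw [toList, length, List.range_succ, List.range_succ]
    exact ((List.Perm.swap _ _ _).trans
      (((ih.cons _).trans (List.perm_append_singleton _ _).symm).cons _)).trans
      (List.perm_append_singleton _ _).symm

theorem lt_length_of_mem {p : PellWord} {x : ℕ} (hx : x ∈ p.toList) : x < p.length :=
  List.mem_range.1 (p.toList_perm.mem_iff.1 hx)

theorem length_pos (p : PellWord) : 0 < p.length := by cases p <;> simp [length]

theorem toList_ne_nil (p : PellWord) : p.toList ≠ [] := by cases p <;> simp [toList]

theorem isP132Word_toList (p : PellWord) : IsP132Word p.toList := by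
  refine ⟨by rw [length_toList]; exact p.toList_perm, ?_, ?_⟩
  · induction p with
    | one =>
      intro a b c _ _ h
      simpa [toList] using h.length_le
    | snoc p ih => exact ih.concat fun x hx => lt_length_of_mem hx
    | cons p ih =>
      refine ih.cons fun b c h _ hs => ?_
      have := lt_length_of_mem (hs.subset (show c ∈ [b, c] by simp))
      omega
    | dbl p ih =>
      refine ListAvoids132.cons (ih.cons fun b c h _ hs => ?_) fun b c h hcb hs => ?_
      · have := lt_length_of_mem (hs.subset (show c ∈ [b, c] by simp))
        omega
      · rcases List.sublist_cons_iff.1 hs with hs | ⟨t, ht, hs⟩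
        · have := lt_length_of_mem (hs.subset (show c ∈ [b, c] by simp))
          omega
        · obtain ⟨rfl, rfl⟩ := List.cons.inj ht
          have := lt_length_of_mem (hs.subset (show c ∈ [c] by simp))
          omega
  · induction p with
    | one => simp [toList, stackSort, stackPass]
    | snoc p ih =>
      rw [toList, stackSort_stackSort_concat fun x hx => lt_length_of_mem hx,
        pairwise_concat_iff fun x hx => lt_length_of_mem (mem_stackSort_stackSort.1 hx)]
      exact ih
    | cons p ih =>
      rw [toList, stackSort_stackSort_cons fun x hx => lt_length_of_mem hx,
        pairwise_concat_iff fun x hx => lt_length_of_mem (mem_stackSort_stackSort.1 hx)]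
      exact ih
    | dbl p ih =>
      have h := stackSort_stackSort_append_cons (L₁ := []) (L₂ := []) (R := p.toList)
        (Nat.lt_succ_self p.length) (by simp) (by simp) fun x hx => lt_length_of_mem hx
      have h0 : stackSort ([] : List ℕ) = [] := rfl
      simp only [List.nil_append, List.cons_append, h0] at h
      rw [toList, h, List.append_cons, pairwise_concat_iff, pairwise_concat_iff]
      · exact ih
      · exact fun x hx => lt_length_of_mem (mem_stackSort_stackSort.1 hx)
      · intro x hx
        rcases List.mem_append.1 hx with hx | hx
        · exact (lt_length_of_mem (mem_stackSort_stackSort.1 hx)).trans (Nat.lt_succ_self _)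
        · rw [List.mem_singleton.1 hx]
          exact Nat.lt_succ_self _

/-- The entries before and after the largest one. -/
def split : PellWord → List ℕ × List ℕ
  | one => ([], [])
  | snoc p => (p.toList, [])
  | cons p => ([], p.toList)
  | dbl p => ([p.length], p.toList)

theorem toList_eq_split (p : PellWord) :
    p.toList = p.split.1 ++ (p.length - 1) :: p.split.2 := by
  cases p <;> simp [toList, split, length]

theorem split_eq_of_toList_eq {p q : PellWord} (h : p.toList = q.toList) : p.split = q.split := by
  have hlen : p.length = q.length := by rw [← length_toList, h, length_toList]
  have hnot (r : PellWord) : r.length - 1 ∉ r.split.1 ∧ r.length - 1 ∉ r.split.2 := by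
    have h : r.toList.Nodup := r.toList_perm.nodup_iff.2 List.nodup_range
    rw [toList_eq_split, List.nodup_middle, List.nodup_cons, List.mem_append] at h
    exact not_or.1 h.1
  rw [toList_eq_split p, toList_eq_split q, hlen] at h
  have := (List.append_cons_inj_of_notMem (hlen ▸ (hnot p).1) (hlen ▸ (hnot p).2)).1 h
  exact Prod.ext this.1 this.2.2

/-- The outermost operation is recognised by which sides of the maximum are empty, because the inner
word never is. -/
theorem toList_injective : Function.Injective toList := by
  intro p
  induction p with
  | one =>
    intro q h
    have := split_eq_of_toList_eq h
    cases q <;> simp_all [split, (toList_ne_nil _).symm]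
  | snoc p ih =>
    intro q h
    have := split_eq_of_toList_eq h
    cases q with
    | snoc q => rw [ih (congrArg Prod.fst this)]
    | _ => simp_all [split, toList_ne_nil, (toList_ne_nil _).symm]
  | cons p ih =>
    intro q h
    have := split_eq_of_toList_eq h
    cases q with
    | cons q => rw [ih (congrArg Prod.snd this)]
    | _ => simp_all [split, toList_ne_nil, (toList_ne_nil _).symm]
  | dbl p ih =>
    intro q h
    have := split_eq_of_toList_eq h
    cases q with
    | dbl q => rw [ih (congrArg Prod.snd this)]
    | _ => simp_all [split, toList_ne_nil]

theorem ncard_incSublists_toList (p : PellWord) (d : ℕ+) :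
    (incSublists d p.toList).ncard = p.expo d := by
  have hone (m : ℕ) (d : ℕ+) :
      (incSublists d [m]).ncard = (Finsupp.single 1 1 : ℕ+ →₀ ℕ) d := by
    obtain ⟨d, rfl⟩ : ∃ e : ℕ, d = e.succPNat := ⟨d.natPred, (PNat.succPNat_natPred d).symm⟩
    rw [Nat.succPNat_coe, Nat.succ_eq_add_one, ncard_incSublists_cons d (by simp)]
    cases d with
    | zero =>
      simp [incSublists_succ_nil, incSublists_zero, show Nat.succPNat 0 = 1 from rfl]
    | succ d =>
      have : (1 : ℕ+) ≠ Nat.succPNat (d + 1) := fun h => by simpa using congrArg PNat.val h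
      simp [incSublists_succ_nil, this]
  have hnil (d : ℕ+) : (incSublists d []).ncard = 0 := by
    obtain ⟨d, rfl⟩ : ∃ e : ℕ, d = e.succPNat := ⟨d.natPred, (PNat.succPNat_natPred d).symm⟩
    simp [incSublists_succ_nil]
  have hfil {q : PellWord} {m : ℕ} (h : q.length ≤ m) : q.toList.filter (m < ·) = [] := by
    rw [List.filter_eq_nil_iff]
    intro x hx
    have := lt_length_of_mem hx
    simp
    omega
  have hnot {q : PellWord} {m : ℕ} (h : q.length ≤ m) : m ∉ q.toList := fun hm =>
    absurd (lt_length_of_mem hm) (by omega)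
  induction p generalizing d with
  | one => exact hone 0 d
  | snoc p ih =>
    rw [toList, expo, Finsupp.add_apply]
    induction d using PNat.recOn with
    | one =>
      rw [PNat.one_coe, ← zero_add 1,
        ncard_incSublists_concat _ fun x hx => lt_length_of_mem hx, shiftExp_apply_one, ← ih]
      simp [incSublists_zero, add_comm]
    | succ d _ =>
      rw [PNat.add_coe, PNat.one_coe,
        ncard_incSublists_concat _ fun x hx => lt_length_of_mem hx, shiftExp_apply_add_one, ← ih,
        ← ih, Finsupp.single_eq_of_ne (pnat_add_one_ne_one d)]
      simp
  | cons p ih =>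
    -- Reading the exponent of x_1 as a count in the word `[p.length]` lets both sides unfold by the
    -- same recursion, without a case split on d.
    rw [toList, expo, Finsupp.add_apply, ← hone p.length, ← ih]
    obtain ⟨d, rfl⟩ : ∃ e : ℕ, d = e.succPNat := ⟨d.natPred, (PNat.succPNat_natPred d).symm⟩
    simp only [Nat.succPNat_coe, Nat.succ_eq_add_one]
    rw [ncard_incSublists_cons d (hnot le_rfl), ncard_incSublists_cons d (by simp), hfil le_rfl,
      incSublists_succ_nil]
    simp [add_comm]
  | dbl p ih =>
    have hcons (d : ℕ+) : (incSublists d ((p.length + 1) :: p.toList)).ncard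
        = (Finsupp.single 1 1 : ℕ+ →₀ ℕ) d + p.expo d := by
      rw [← hone p.length, ← ih]
      obtain ⟨d, rfl⟩ : ∃ e : ℕ, d = e.succPNat := ⟨d.natPred, (PNat.succPNat_natPred d).symm⟩
      simp only [Nat.succPNat_coe, Nat.succ_eq_add_one]
      rw [ncard_incSublists_cons d (hnot (Nat.le_succ _)), ncard_incSublists_cons d (by simp),
        hfil (Nat.le_succ _), incSublists_succ_nil]
      simp [add_comm]
    have hnm : p.length ∉ (p.length + 1) :: p.toList := by
      simpa using hnot (le_refl p.length)
    -- Only its right neighbour exceeds the leading entry, which thus starts one singleton and one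
    -- pair: the factor x_1 x_2.
    have hf : ((p.length + 1) :: p.toList).filter (p.length < ·) = [p.length + 1] := by
      rw [List.filter_cons_of_pos (by simp), hfil le_rfl]
    rw [toList, expo, Finsupp.add_apply, Finsupp.add_apply]
    induction d using PNat.recOn with
    | one =>
      have := hcons 1
      rw [PNat.one_coe, ← zero_add 1] at this ⊢
      rw [ncard_incSublists_cons _ hnm, this, hf, incSublists_zero, shiftExp_apply_one]
      simp
      omega
    | succ d _ =>
      have := hcons (d + 1)
      rw [PNat.add_coe, PNat.one_coe] at this ⊢
      rw [ncard_incSublists_cons _ hnm, this, hf, hone, shiftExp_apply_add_one,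
        Finsupp.single_eq_of_ne (pnat_add_one_ne_one d)]
      omega

end PellWord

/-- Strong induction on the length, splitting the word at its largest entry N. When both sides are
nonempty, sortedness forces the left side to be the single entry N - 1. -/
theorem IsP132Word.exists_toList_eq {l : List ℕ} (h : IsP132Word l) (hl : l ≠ []) :
    ∃ p : PellWord, p.toList = l := by
  induction hn : l.length using Nat.strong_induction_on generalizing l with
  | _ n ih =>
  subst hn
  obtain ⟨hperm, hav, hsort⟩ := h
  obtain ⟨N, hN⟩ : ∃ N, l.length = N + 1 := ⟨l.length - 1, by
    have := List.length_pos_iff.2 hl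
    omega⟩
  have hmem : N ∈ l := hperm.mem_iff.2 (by simp [hN])
  obtain ⟨L, R, rfl⟩ := List.append_of_mem hmem
  rw [hN, List.range_succ] at hperm
  have hLR : (L ++ R).Perm (List.range N) := by
    have := (List.perm_middle.symm.trans hperm).trans (List.perm_append_singleton _ _)
    exact (List.perm_cons N).1 this
  have hlt : ∀ x ∈ L ++ R, x < N := fun x hx => List.mem_range.1 (hLR.mem_iff.1 hx)
  have hL : ∀ x ∈ L, x < N := fun x hx => hlt x (List.mem_append_left _ hx)
  have hR : ∀ x ∈ R, x < N := fun x hx => hlt x (List.mem_append_right _ hx)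
  have hnodup : (L ++ R).Nodup := hLR.nodup_iff.2 List.nodup_range
  have hRL : ∀ a ∈ L, ∀ r ∈ R, r < a := by
    intro a ha r hr
    by_contra hle
    have hne : a ≠ r := (List.nodup_append.1 hnodup).2.2 a ha r hr
    -- Otherwise a, N, r would be an occurrence of 132.
    refine hav a N r (by omega) (hR r hr) ?_
    exact (List.singleton_sublist.2 ha).append ((List.singleton_sublist.2 hr).cons_cons N)
  have hlen : L.length + R.length = N := by simpa using hLR.length_eq
  rcases eq_or_ne R [] with rfl | hRne
  · rw [List.append_nil] at hLR
    rcases eq_or_ne L [] with rfl | hLne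
    · have : N = 0 := by simpa using hlen.symm
      subst this
      exact ⟨.one, rfl⟩
    · have hLN : L.length = N := by simpa using hlen
      obtain ⟨p, hp⟩ := ih L.length (by simp) (l := L)
        ⟨by rwa [hLN], hav.sublist (List.sublist_append_left _ _), by
          rwa [stackSort_stackSort_concat hL, pairwise_concat_iff
            fun x hx => hL x (mem_stackSort_stackSort.1 hx)] at hsort⟩ hLne rfl
      refine ⟨.snoc p, ?_⟩
      rw [PellWord.toList, ← PellWord.length_toList, hp, hLN]
  · have hRav : ListAvoids132 R := hav.sublist
      ((List.sublist_cons_self _ _).trans (List.sublist_append_right _ _))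
    rcases eq_or_ne L [] with rfl | hLne
    · have hRN : R.length = N := by simpa using hlen
      rw [List.nil_append] at hLR hsort
      obtain ⟨p, hp⟩ := ih R.length (by simp) (l := R)
        ⟨by rwa [hRN], hRav, by
          rwa [stackSort_stackSort_cons hR, pairwise_concat_iff
            fun x hx => hR x (mem_stackSort_stackSort.1 hx)] at hsort⟩ hRne rfl
      refine ⟨.cons p, ?_⟩
      rw [PellWord.toList, ← PellWord.length_toList, hp, hRN, List.nil_append]
    · obtain ⟨M, hM, hmax⟩ : ∃ M ∈ L, ∀ x ∈ L, x ≤ M := by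
        obtain ⟨M, hM, h⟩ := L.toFinset.exists_max_image id
          (by simpa [List.toFinset_nonempty_iff] using hLne)
        exact ⟨M, by simpa using hM, by simpa using h⟩
      obtain ⟨L₁, L₂, rfl⟩ := List.append_of_mem hM
      have hMnot : M ∉ L₁ ++ L₂ := by
        have := (List.nodup_append.1 hnodup).1
        rw [List.nodup_middle, List.nodup_cons] at this
        exact this.1
      have hltM : ∀ x ∈ L₁ ++ L₂, x < M := by
        intro x hx
        refine lt_of_le_of_ne (hmax x ?_) fun h => hMnot (h ▸ hx)
        simp only [List.mem_append, List.mem_cons] at hx ⊢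
        tauto
      rw [stackSort_stackSort_append_cons (hL M hM)
        (fun x hx => hltM x (List.mem_append_left _ hx))
        (fun x hx => hltM x (List.mem_append_right _ hx)) (hRL M hM)] at hsort
      have hsort' := List.pairwise_append.1 (List.pairwise_append.1 hsort).1
      -- After two passes an entry of L₁ or L₂ would precede the smaller entries of R.
      have hempty : L₁ ++ L₂ = [] := by
        by_contra hne
        obtain ⟨x, hx⟩ := List.exists_mem_of_ne_nil _ hne
        obtain ⟨r, hr⟩ := List.exists_mem_of_ne_nil _ hRne
        have h1 := hsort'.2.2 x (by
          rw [(stackSort_perm _).mem_iff]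
          simpa only [List.mem_append, (stackSort_perm _).mem_iff] using hx) r
          (mem_stackSort_stackSort.2 hr)
        have h2 := hRL x (by
          simp only [List.mem_append, List.mem_cons] at hx ⊢
          tauto) r hr
        omega
      obtain ⟨rfl, rfl⟩ := List.append_eq_nil_iff.1 hempty
      have hRN : R.length + 1 = N := by simpa [add_comm] using hlen
      -- The value N - 1 occurs in M R; lying in R it would be smaller than M, while M < N.
      have hMN : M = R.length := by
        have hN1 : R.length ∈ [] ++ [M] ++ R := hLR.mem_iff.2 (by simp; omega)
        have hM1 := hL M hM
        simp only [List.nil_append, List.cons_append, List.mem_cons] at hN1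
        rcases hN1 with h | h
        · exact h.symm
        · have := hRL M hM _ h
          omega
      subst hMN
      have hRperm : R.Perm (List.range R.length) := by
        rw [← hRN, List.range_succ] at hLR
        exact (List.perm_cons _).1 (hLR.trans (List.perm_append_singleton _ _))
      obtain ⟨p, hp⟩ := ih R.length (by simp) (l := R) ⟨hRperm, hRav, hsort'.2.1⟩ hRne rfl
      refine ⟨.dbl p, ?_⟩
      rw [PellWord.toList, ← PellWord.length_toList, hp, hRN]
      rfl

/-! ### From permutations to words of natural numbers -/

/-- One-line notation with entries in `ℕ`. -/
def permWord {n : ℕ} (π : Equiv.Perm (Fin n)) : List ℕ := List.ofFn fun i => (π i : ℕ)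

theorem length_permWord {n : ℕ} (π : Equiv.Perm (Fin n)) : (permWord π).length = n := by
  simp [permWord]

theorem permWord_eq_map {n : ℕ} (π : Equiv.Perm (Fin n)) :
    permWord π = (oneLine π).map Fin.val := by
  rw [permWord, oneLine, List.map_ofFn]
  rfl

theorem permWord_perm {n : ℕ} (π : Equiv.Perm (Fin n)) : (permWord π).Perm (List.range n) := by
  refine (List.perm_ext_iff_of_nodup ?_ List.nodup_range).2 fun x => ?_
  · exact List.nodup_ofFn.2 (Fin.val_injective.comp π.injective)
  · rw [permWord, List.mem_ofFn, List.mem_range]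
    constructor
    · rintro ⟨i, rfl⟩
      exact (π i).isLt
    · exact fun hx => ⟨π.symm ⟨x, hx⟩, by simp⟩

theorem sublist_permWord_iff {n d : ℕ} (π : Equiv.Perm (Fin n)) (t : Fin d → ℕ) :
    (List.ofFn t).Sublist (permWord π) ↔ ∃ f : Fin d ↪o Fin n, ∀ i, t i = π (f i) := by
  rw [List.sublist_iff_exists_fin_orderEmbedding_get_eq]
  constructor
  · rintro ⟨f, hf⟩
    refine ⟨((Fin.castOrderIso (List.length_ofFn (f := t))).symm.toOrderEmbedding.trans f).trans
      (Fin.castOrderIso (length_permWord π)).toOrderEmbedding, fun i => ?_⟩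
    refine Eq.trans ?_ ((hf (Fin.cast (List.length_ofFn (f := t)).symm i)).trans ?_)
    · simp
    · rw [List.get_eq_getElem]
      exact List.getElem_ofFn _
  · rintro ⟨f, hf⟩
    refine ⟨((Fin.castOrderIso (List.length_ofFn (f := t))).toOrderEmbedding.trans f).trans
      (Fin.castOrderIso (length_permWord π)).symm.toOrderEmbedding, fun i => ?_⟩
    refine Eq.trans ?_ ((hf (Fin.cast (List.length_ofFn (f := t)) i)).trans ?_)
    · rw [List.get_eq_getElem]
      exact List.getElem_ofFn _
    · rw [List.get_eq_getElem]
      exact (List.getElem_ofFn (f := fun i => (π i : ℕ)) _).symm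

/-- The entries of a permutation are distinct, so a subsequence determines its positions, and
counting value lists is the same as counting position embeddings. -/
theorem ncard_incSublists_permWord {n : ℕ} (d : ℕ) (π : Equiv.Perm (Fin n)) :
    (incSublists d (permWord π)).ncard = incCount d π := by
  have h : incSublists d (permWord π)
      = (fun f : Fin d ↪o Fin n => List.ofFn fun i => (π (f i) : ℕ)) ''
        patternOccurrences (1 : Equiv.Perm (Fin d)) π := by
    ext l
    simp only [incSublists, patternOccurrences, Set.mem_ofPred_eq, Set.mem_image]
    constructor
    · rintro ⟨hs, rfl, hp⟩
      rw [← List.ofFn_get l, sublist_permWord_iff] at hs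
      obtain ⟨f, hf⟩ := hs
      have hmono : StrictMono l.get := hp.sortedLT.strictMono_get
      refine ⟨f, fun i j => ?_, ?_⟩
      · rw [Fin.lt_def, ← hf, ← hf, hmono.lt_iff_lt]
        rfl
      · simp only [← hf]
        exact List.ofFn_get l
    · rintro ⟨f, hf, rfl⟩
      refine ⟨(sublist_permWord_iff π _).2 ⟨f, fun _ => rfl⟩, List.length_ofFn, ?_⟩
      rw [List.pairwise_ofFn]
      exact fun i j hij => (hf i j).2 hij
  rw [h, incCount, Set.ncard_image_of_injective]
  intro f g hfg
  ext i
  have := congrFun (List.ofFn_injective hfg) i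
  exact congrArg Fin.val (π.injective (Fin.val_injective this))

theorem avoidsPattern_perm132_iff {n : ℕ} (π : Equiv.Perm (Fin n)) :
    AvoidsPattern perm132 π ↔ ListAvoids132 (permWord π) := by
  rw [AvoidsPattern, Set.eq_empty_iff_forall_notMem]
  constructor
  · intro h a b c hac hcb hs
    have h3 : [a, b, c] = List.ofFn ![a, b, c] := by simp
    rw [h3, sublist_permWord_iff] at hs
    obtain ⟨f, hf⟩ := hs
    refine h f fun i j => ?_
    rw [Fin.lt_def, ← hf, ← hf]
    fin_cases i <;> fin_cases j <;> simp [perm132, Equiv.swap_apply_def] <;> omega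
  · intro h f hf
    refine h (π (f 0)) (π (f 1)) (π (f 2)) ((hf 0 2).2 (by decide)) ((hf 2 1).2 (by decide)) ?_
    have h3 : [(π (f 0) : ℕ), (π (f 1) : ℕ), (π (f 2) : ℕ)]
        = List.ofFn fun i : Fin 3 => (π (f i) : ℕ) := by simp [List.ofFn_succ]
    rw [h3, sublist_permWord_iff]
    exact ⟨f, fun _ => rfl⟩

/-- Two passes only rearrange the entries, and the increasing rearrangement is unique; passes
commute with the order embedding of `Fin n` in ℕ. -/
theorem isTwoStackSortable_iff {n : ℕ} (π : Equiv.Perm (Fin n)) :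
    IsTwoStackSortable π ↔ (stackSort (stackSort (permWord π))).Pairwise (· < ·) := by
  rw [permWord_eq_map, stackSort_map Fin.val_strictMono, stackSort_map Fin.val_strictMono,
    List.pairwise_map]
  have hone : oneLine (1 : Equiv.Perm (Fin n)) = List.finRange n := by
    rfl
  have hp : (List.finRange n).Pairwise (fun a b : Fin n => (a : ℕ) < b) := by
    rw [List.finRange, List.pairwise_ofFn]
    exact fun i j h => h
  rw [IsTwoStackSortable, hone]
  constructor
  · intro h
    rw [h]
    exact hp
  · intro h
    refine List.Perm.eq_of_pairwise (le := fun a b : Fin n => (a : ℕ) < b) ?_ h hp ?_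
    · intro a b _ _ h1 h2
      exact absurd h1 h2.not_gt
    · refine ((stackSort_perm _).trans (stackSort_perm _)).trans ?_
      refine (List.perm_ext_iff_of_nodup ?_ (List.nodup_finRange n)).2 fun x => ?_
      · exact List.nodup_ofFn.2 π.injective
      · simp only [oneLine, List.mem_ofFn, List.mem_finRange, iff_true]
        exact π.surjective x

theorem isP132Word_permWord_iff (π : Σ n : ℕ, Equiv.Perm (Fin n)) :
    IsP132Word (permWord π.2) ↔ π ∈ P132 := by
  rw [IsP132Word, length_permWord, ← avoidsPattern_perm132_iff, ← isTwoStackSortable_iff]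
  exact ⟨fun h => ⟨h.2.2, h.2.1⟩, fun h => ⟨permWord_perm _, h.2, h.1⟩⟩

theorem permWord_injective :
    Function.Injective fun π : Σ n : ℕ, Equiv.Perm (Fin n) => permWord π.2 := by
  rintro ⟨n, π⟩ ⟨m, ρ⟩ h
  obtain rfl : n = m := by
    rw [← length_permWord π, ← length_permWord ρ]
    exact congrArg _ h
  have := List.ofFn_injective h
  congr 1
  ext i
  exact congrFun this i

theorem exists_permWord_eq {l : List ℕ} (h : l.Perm (List.range l.length)) :
    ∃ π : Σ n : ℕ, Equiv.Perm (Fin n), permWord π.2 = l := by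
  have hlt (i : Fin l.length) : l.get i < l.length :=
    List.mem_range.1 (h.mem_iff.1 (List.get_mem l i))
  have hinj : Function.Injective fun i : Fin l.length => (⟨l.get i, hlt i⟩ : Fin l.length) := by
    intro i j hij
    exact List.nodup_iff_injective_get.1 (h.nodup_iff.2 List.nodup_range) (Fin.mk.inj hij)
  refine ⟨⟨l.length, Equiv.ofBijective _ (Finite.injective_iff_bijective.1 hinj)⟩, ?_⟩
  exact List.ofFn_get l

/-! ### The coding of P(132) and the identity -/

/-- The one-line notation of a coded permutation, `none` coding the empty permutation. -/
def optionPellWordToList : Option PellWord → List ℕ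
  | none => []
  | some p => p.toList

theorem optionPellWordToList_injective : Function.Injective optionPellWordToList := by
  rintro (_ | p) (_ | q) h
  · rfl
  · exact absurd h.symm q.toList_ne_nil
  · exact absurd h p.toList_ne_nil
  · rw [PellWord.toList_injective h]

theorem range_optionPellWordToList :
    Set.range optionPellWordToList = {l | IsP132Word l} := by
  ext l
  constructor
  · rintro ⟨_ | p, rfl⟩
    · refine ⟨by simp [optionPellWordToList], fun a b c _ _ h => ?_, ?_⟩
      · simpa [optionPellWordToList] using h.length_le
      · simp [optionPellWordToList, stackSort, stackPass]
    · exact p.isP132Word_toList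
  · intro h
    rcases eq_or_ne l [] with rfl | hl
    · exact ⟨none, rfl⟩
    · obtain ⟨p, rfl⟩ := h.exists_toList_eq hl
      exact ⟨some p, rfl⟩

theorem range_permWord_P132 :
    (Set.range fun π : P132 => permWord π.1.2) = {l | IsP132Word l} := by
  ext l
  constructor
  · rintro ⟨π, rfl⟩
    exact (isP132Word_permWord_iff π.1).2 π.2
  · intro h
    obtain ⟨π, rfl⟩ := exists_permWord_eq h.1
    exact ⟨⟨π, (isP132Word_permWord_iff π).1 h⟩, rfl⟩

/-- The coding of the `132`-avoiding two-stack sortable permutations. -/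
noncomputable def optionPellWordEquivP132 : Option PellWord ≃ P132 :=
  (Equiv.ofInjective _ optionPellWordToList_injective).trans <|
    (Equiv.setCongr (range_optionPellWordToList.trans range_permWord_P132.symm)).trans
      (Equiv.ofInjective _ (permWord_injective.comp Subtype.val_injective)).symm

theorem permWord_optionPellWordEquivP132 (p : Option PellWord) :
    permWord (optionPellWordEquivP132 p).1.2 = optionPellWordToList p :=
  Equiv.apply_ofInjective_symm (permWord_injective.comp Subtype.val_injective) _

theorem incCount_optionPellWordEquivP132_none (d : ℕ+) :
    incCount d (optionPellWordEquivP132 none).1.2 = 0 := by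
  rw [← ncard_incSublists_permWord, permWord_optionPellWordEquivP132, optionPellWordToList]
  obtain ⟨d, rfl⟩ : ∃ e : ℕ, d = e.succPNat := ⟨d.natPred, (PNat.succPNat_natPred d).symm⟩
  simp [incSublists_succ_nil]

theorem incCount_optionPellWordEquivP132_some (p : PellWord) (d : ℕ+) :
    incCount d (optionPellWordEquivP132 (some p)).1.2 = p.expo d := by
  rw [← ncard_incSublists_permWord, permWord_optionPellWordEquivP132, optionPellWordToList,
    PellWord.ncard_incSublists_toList]

theorem hasSum_P132 :
    HasSum (fun π : P132 =>
        (∏ᶠ d : ℕ+, MvPowerSeries.X d ^ incCount d π.1.2 : MvPowerSeries ℕ+ ℤ))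
      (1 + PellWord.genFun 0) := by
  rw [← optionPellWordEquivP132.hasSum_iff,
    ← (Equiv.optionEquivSumPUnit.{0} PellWord).symm.hasSum_iff, add_comm]
  refine HasSum.sum ((PellWord.hasSum_genFun 0).congr_fun fun p => ?_) ?_
  · simp [incCount_optionPellWordEquivP132_some, finprod_X_pow]
  · convert hasSum_unique _ using 1
    -- The empty permutation has no increasing subsequence of positive length, so its monomial is
    -- the summand 1.
    · simp [incCount_optionPellWordEquivP132_none]
    · infer_instance

theorem mainTheorem7 :
    Summable (fun π : P132 =>
        (∏ᶠ d : ℕ+, MvPowerSeries.X d ^ incCount d π.1.2 : MvPowerSeries ℕ+ ℤ)) ∧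
    Summable (fun n : ℕ+ =>
        (∏ᶠ j : ℕ+, MvPowerSeries.X j ^ (n : ℕ).choose j : MvPowerSeries ℕ+ ℤ) * denomInv n) ∧
    ∑' π : P132, (∏ᶠ d : ℕ+, MvPowerSeries.X d ^ incCount d π.1.2 : MvPowerSeries ℕ+ ℤ)
      = 1 + ∑' n : ℕ+,
          (∏ᶠ j : ℕ+, MvPowerSeries.X j ^ (n : ℕ).choose j : MvPowerSeries ℕ+ ℤ) * denomInv n := by
  have h (n : ℕ+) : (∏ᶠ j : ℕ+, MvPowerSeries.X j ^ (n : ℕ).choose j : MvPowerSeries ℕ+ ℤ)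
      * denomInv n = PellWord.term n := by
    simp only [← chooseSumExp_apply, finprod_X_pow, PellWord.term]
  simp only [h]
  exact ⟨hasSum_P132.summable, PellWord.hasSum_term.summable, by
    rw [hasSum_P132.tsum_eq, PellWord.hasSum_term.tsum_eq]⟩
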